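/- Let $k$ be a natural number and let $\Delta=\{x\in\mathbb R^k : x\ge 0,\ \sum_i x_i=1\}$ be the $k$-simplex, with vertices $v_1,\dots,v_k$ (the standard basis vectors). An edge of $\Delta$ is an unordered pair $e=\{p,q\}$ of distinct points of $\Delta$; its length is $|e|=\tfrac12\sum_{\ell}|p_\ell-q_\ell|$ (with the same formula, giving $0$, if $p=q$). A $k$-way cut of a graph with $k$ terminals is a set $C$ of its edges such that after removing $C$ no path joins two different terminals. A $k$-way cut of the simplex is a $k$-way cut of the graph of all edges of $\Delta$, with terminals $v_1,\dots,v_k$. A cutting scheme is a probability distribution $P$ on the $k$-way cuts of the simplex (on the $\sigma$-algebra generated by the events $\{e\in C\}$). Its maximum density is $\tau_k(P)=\sup_e \Pr_{C\sim P}[e\in C]/|e|$, where $e$ ranges over all edges of $\Delta$, and $\tau_k^*=\inf_P\tau_k(P)$, where $P$ ranges over all cutting schemes. For a finite graph $G$ with nonnegative edge costs and $k$ distinct terminals, an embedding of $G$ is a map $\varphi$ from its nodes to $\Delta$ that sends the $i$-th terminal to $v_i$, and its volume is $\sum_{uv\in E(G)}\mathrm{cost}(uv)\,|\{\varphi(u),\varphi(v)\}|$.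 The integrality gap of the relaxation is the supremum, over all such weighted graphs $G$, of the minimum cost of a $k$-way cut of $G$ divided by the minimum volume of an embedding of $G$ (with $0/0=0$). **Theorem.** For every $k$ there exists a cutting scheme $P$ whose maximum density $\tau_k(P)$ equals the integrality gap; moreover $P$ can be taken to be the distribution of the cut induced by a random partition of $\Delta$ into $k$ labelled blocks, the $i$-th block containing the $i$-th vertex and no other vertex (the induced cut being the set of edges with endpoints in different blocks). Consequently $\tau_k^*$ equals the integrality gap. -/

import Mathlib

open MeasureTheory
open scoped ENNReal NNReal

noncomputable section

namespace MultiwayCut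

/-- The `k`-simplex `Δ = {x ∈ ℝ^k : x ≥ 0, ∑ x_i = 1}`, as a type. -/
abbrev Simplex (k : ℕ) : Type := stdSimplex ℝ (Fin k)

/-- The `i`-th vertex of the simplex: the `i`-th coordinate is `1`, the others are `0`. -/
def vertex {k : ℕ} (i : Fin k) : Simplex k :=
  ⟨Pi.single i 1, single_mem_stdSimplex ℝ i⟩

/-- The length of a segment of the simplex: half the `L¹` distance between its endpoints. -/
def edgeLength {k : ℕ} : Sym2 (Simplex k) → ℝ≥0∞ :=
  Sym2.lift ⟨fun p q => ENNReal.ofReal ((∑ l : Fin k, |p.1 l - q.1 l|) / 2), by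
    intro p q
    simp only [abs_sub_comm]⟩

/-- A `k`-way cut of a graph `G` with terminals `t 0, …, t (k-1)`: a set `C` of edges of `G` such
that `G - C` contains no path between two different terminals. -/
def IsKWayCut {V : Type*} {k : ℕ} (G : SimpleGraph V) (t : Fin k → V) (C : Set (Sym2 V)) : Prop :=
  C ⊆ G.edgeSet ∧ ∀ i j : Fin k, i ≠ j → ¬ (G.deleteEdges C).Reachable (t i) (t j)

/-! ### Weighted graphs, embeddings, and the integrality gap -/

/-- An instance of the minimum `k`-way cut problem: a finite graph with nonnegative edge costs and
`k` distinct terminals. -/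
structure WeightedGraph (k : ℕ) where
  /-- the number of nodes -/
  n : ℕ
  graph : SimpleGraph (Fin n)
  cost : Sym2 (Fin n) → ℝ≥0
  terminal : Fin k ↪ Fin n

namespace WeightedGraph

variable {k : ℕ} (G : WeightedGraph k)

/-- The total cost of a set of edges. -/
def cutCost (C : Set (Sym2 (Fin G.n))) : ℝ≥0∞ := ∑' e : C, (G.cost e : ℝ≥0∞)

/-- The minimum cost of a `k`-way cut. -/
def minCut : ℝ≥0∞ :=
  ⨅ C : {C : Set (Sym2 (Fin G.n)) // IsKWayCut G.graph G.terminal C}, G.cutCost C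

/-- The feasible solutions of the relaxation: maps from the nodes to the simplex (not necessarily
injective) that send the `i`-th terminal to the `i`-th vertex. -/
def Embedding : Type := {φ : Fin G.n → Simplex k // ∀ i, φ (G.terminal i) = vertex i}

/-- The volume of an embedding: `∑_e cost(e) · |e|`. -/
def vol (φ : G.Embedding) : ℝ≥0∞ :=
  ∑' e : G.graph.edgeSet, (G.cost e : ℝ≥0∞) * edgeLength (Sym2.map φ.1 e)

/-- The optimal value of the relaxation. -/
def minVol : ℝ≥0∞ := ⨅ φ : G.Embedding, G.vol φ

end WeightedGraph

/-- The integrality gap of the relaxation: the supremum, over all weighted graphs, of the minimum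
cost of a `k`-way cut divided by the minimum volume of an embedding. (If the minimum volume is `0`
then so is the minimum cut, and the quotient `0 / 0 = 0` does not affect the supremum.) -/
def integralityGap (k : ℕ) : ℝ≥0∞ := ⨆ G : WeightedGraph k, G.minCut / G.minVol

/-! ### Cutting schemes and their densities -/

/-- The `k`-way cuts of the simplex: `k`-way cuts of the set of all edges of the simplex (all pairs
of distinct points), the terminals being the vertices. The (instance) σ-algebra on this type
is the one generated by the events `e ∈ C`, for `e` an edge. -/
abbrev SimplexCut (k : ℕ) : Type :=
  {C : Set (Sym2 (Simplex k)) // IsKWayCut (⊤ : SimpleGraph (Simplex k)) vertex C}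

/-- A cutting scheme: a probability distribution on `k`-way cuts of the simplex. -/
abbrev CuttingScheme (k : ℕ) : Type := ProbabilityMeasure (SimplexCut k)

/-- The density `τ_k(P, e)`: the probability that `P` cuts `e`, divided by the length of `e`. -/
def density {k : ℕ} (P : CuttingScheme k) (e : Sym2 (Simplex k)) : ℝ≥0∞ :=
  (P : Measure (SimplexCut k)) {C | e ∈ C.1} / edgeLength e

/-- The maximum density `τ_k(P) = sup_e τ_k(P, e)`. -/
def maxDensity {k : ℕ} (P : CuttingScheme k) : ℝ≥0∞ :=
  ⨆ e : (⊤ : SimpleGraph (Simplex k)).edgeSet, density P e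

/-- The minimal maximum density `τ_k^* = inf_P τ_k(P)`. -/
def minMaxDensity (k : ℕ) : ℝ≥0∞ := ⨅ P : CuttingScheme k, maxDensity P

/-! ### Cuts given by partitions of the simplex -/

/-- A partition of the simplex into `k` labelled blocks, the `i`-th of which contains the `i`-th
vertex and no other; `f p` is the label of the block of `p`. The (instance) σ-algebra is
generated by the events `f p = i`. -/
abbrev SimplexPartition (k : ℕ) : Type :=
  {f : Simplex k → Fin k // ∀ i, f (vertex i) = i}

/-- The cut induced by a partition: all edges with endpoints in different blocks. -/
def SimplexPartition.toCut {k : ℕ} (f : SimplexPartition k) : SimplexCut k :=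
  ⟨{e | ¬ (Sym2.map f.1 e).IsDiag}, by
    refine ⟨?_, ?_⟩
    · intro e
      induction e with
      | _ p q =>
        simp only [Set.mem_ofPred_eq, Sym2.map_mk, Sym2.mk_isDiag_iff,
          SimpleGraph.mem_edgeSet, SimpleGraph.top_adj]
        exact fun h hpq => h (congrArg f.1 hpq)
    · rintro i j hij ⟨w⟩
      have key : ∀ {p q : Simplex k},
          ((⊤ : SimpleGraph (Simplex k)).deleteEdges
            {e | ¬ (Sym2.map f.1 e).IsDiag}).Walk p q → f.1 p = f.1 q := by
        intro p q w
        induction w with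
        | nil => rfl
        | cons h _ ih =>
          rw [SimpleGraph.deleteEdges_adj] at h
          have h2 := h.2
          simp only [Set.mem_ofPred_eq, not_not, Sym2.map_mk, Sym2.mk_isDiag_iff] at h2
          exact h2.trans ih
      have := key w
      rw [f.2, f.2] at this
      exact hij this⟩

end MultiwayCut

end

/-!
# Optimal cutting schemes attain the integrality gap

Every cutting scheme `P` bounds the integrality gap by its maximum density. A `k`-way cut of the
simplex pulls back along an embedding of `G` to a `k`-way cut of `G`
(`IsKWayCut.preimage`), so the expected cost of the pulled-back cut is at least the minimum cut,
while by linearity of expectation it is at most `maxDensity P` times the volume of the embedding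
(`WeightedGraph.minCut_le_maxDensity_mul_vol`).

For the converse, let `α` be the integrality gap, assumed finite (if it is infinite, the first
part shows that every scheme is optimal). Given finitely many weighted pairs of points of the
simplex, the points together with the vertices form a weighted graph embedded in the simplex. A
minimum `k`-way cut of that graph costs at most `α` times the volume, and labelling each node by
the terminal from which it can be reached turns this cut into a partition of the simplex
(`exists_partition_sum_le`). So for each finite nonnegative combination of the constraints
`Pr[e is cut] ≤ α |e|` there is a partition that satisfies the combined constraint.

A minimax argument replaces the partition depending on the combination by one random partition
satisfying all the constraints at once (`exists_probabilityMeasure_le_of_borelSpace`). The space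
`X` of partitions is a closed subspace of a product of finite discrete spaces, hence compact, and
the events `e is cut` are clopen. In `C(X, ℝ)` the cone spanned by the functions
`α |e| - 1_{e is cut}` misses the open convex set of negative functions, so by Hahn–Banach some
nonzero functional separates them; it is positive, and by the Riesz–Markov–Kakutani theorem it is,
up to a scalar, integration against a probability measure. No separate limiting argument from
finite sets of points to the whole simplex is needed.
-/

open MeasureTheory
open scoped ENNReal NNReal

namespace MultiwayCut

/-! ### A minimax theorem for clopen events in a compact space -/

section Minimax

variable {X ι : Type*} [TopologicalSpace X] [CompactSpace X] [T2Space X]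

/-- If every finite nonnegative combination of the constraints `1_{A i} ≤ b i` is satisfied at some
point, then the constraints are satisfied simultaneously on average, for some probability
measure. The measure represents a functional that separates the cone spanned by the functions
`b i - 1_{A i}` from the negative functions. Taking `c = 0` in the hypothesis shows that `X` is
nonempty. -/
theorem exists_probabilityMeasure_le_of_borelSpace [MeasurableSpace X] [BorelSpace X]
    {A : ι → Set X} (hA : ∀ i, IsClopen (A i)) (b : ι → ℝ≥0)
    (h : ∀ c : ι →₀ ℝ≥0, ∃ x, ∑ i ∈ c.support, c i * (A i).indicator 1 x ≤
      ∑ i ∈ c.support, c i * b i) :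
    ∃ μ : Measure X, IsProbabilityMeasure μ ∧ ∀ i, μ (A i) ≤ b i := by
  let χ : ι → C(X, ℝ) := fun i => (LocallyConstant.charFn ℝ (hA i) : C(X, ℝ))
  have hχ : ∀ i x, χ i x = (((A i).indicator 1 x : ℝ≥0) : ℝ) := by
    intro i x
    by_cases hx : x ∈ A i <;> simp [χ, LocallyConstant.charFn, hx]
  let v : ι → C(X, ℝ) := fun i => algebraMap ℝ C(X, ℝ) (b i) - χ i
  let K : Submodule ℝ≥0 C(X, ℝ) := Submodule.span ℝ≥0 (Set.range v)
  let N : Set C(X, ℝ) := {g | ∀ x, g x < 0}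
  have hN : IsOpen N := by
    have : N = {g : C(X, ℝ) | Set.MapsTo g Set.univ (Set.Iio 0)} := by
      ext g; simp [N, Set.MapsTo]
    rw [this]
    exact ContinuousMap.isOpen_setOfPred_mapsTo isCompact_univ isOpen_Iio
  have hNc : Convex ℝ N := by
    intro g hg g' hg' s t hs ht hst x
    have h1 := hg x
    have h2 := hg' x
    simp only [ContinuousMap.add_apply, ContinuousMap.smul_apply, smul_eq_mul]
    rcases hs.eq_or_lt with rfl | hs
    · have : t = 1 := by linarith
      simpa [this] using h2
    · nlinarith [mul_neg_of_pos_of_neg hs h1, mul_nonpos_of_nonneg_of_nonpos ht h2.le]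
  have hKc : Convex ℝ (K : Set C(X, ℝ)) := by
    intro g hg g' hg' s t hs ht _
    exact K.add_mem (K.smul_mem ⟨s, hs⟩ hg) (K.smul_mem ⟨t, ht⟩ hg')
  have hdisj : Disjoint N (K : Set C(X, ℝ)) := by
    rw [Set.disjoint_left]
    intro g hg hgK
    obtain ⟨c, rfl⟩ := Finsupp.mem_span_range_iff_exists_finsupp.1 hgK
    obtain ⟨x, hx⟩ := h c
    have h1 := hg x
    have h2 : ∑ i ∈ c.support, (c i : ℝ) * (((A i).indicator 1 x : ℝ≥0) : ℝ) ≤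
      ∑ i ∈ c.support, (c i : ℝ) * (b i : ℝ) := by exact_mod_cast hx
    have h3 : (c.sum fun i a => a • v i) x = ∑ i ∈ c.support, (c i : ℝ) * (b i : ℝ) -
        ∑ i ∈ c.support, (c i : ℝ) * (((A i).indicator 1 x : ℝ≥0) : ℝ) := by
      rw [Finsupp.sum, ContinuousMap.sum_apply, ← Finset.sum_sub_distrib]
      refine Finset.sum_congr rfl fun i _ => ?_
      simp [v, hχ, NNReal.smul_def, mul_sub]
    linarith
  obtain ⟨F, u, hFN, hFK⟩ := geometric_hahn_banach_open hNc hN hKc hdisj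
  have hu : u ≤ 0 := by simpa using hFK 0 K.zero_mem
  -- A linear functional bounded below on a cone is nonnegative on it.
  have hFv : ∀ i, 0 ≤ F (v i) := by
    intro i
    by_contra! hlt
    have hmem : ((u - 1) / F (v i)) • v i ∈ K :=
      K.smul_mem ⟨(u - 1) / F (v i), div_nonneg_of_nonpos (by linarith) hlt.le⟩
        (Submodule.subset_span ⟨i, rfl⟩)
    have := hFK _ hmem
    rw [map_smul, smul_eq_mul, div_mul_cancel₀ _ hlt.ne] at this
    linarith
  have hF1 : 0 < F 1 := by
    have : F (-1) < u := hFN _ fun x => by simp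
    rw [map_neg] at this
    linarith
  have hF0 : ∀ g : C(X, ℝ), 0 ≤ g → 0 ≤ F g := by
    intro g hg
    by_contra! hlt
    -- `-g - ε` is negative for every `ε > 0`; take `ε` with `ε * F 1 = -F g`.
    have : F (-g - (-F g / F 1) • 1) < u := hFN _ fun x => by
      have h1 : 0 ≤ g x := hg x
      have h2 : 0 < -F g / F 1 := div_pos (by linarith) hF1
      simp only [ContinuousMap.sub_apply, ContinuousMap.neg_apply, ContinuousMap.smul_apply,
        ContinuousMap.one_apply, smul_eq_mul, mul_one]
      linarith
    rw [map_sub, map_neg, map_smul, smul_eq_mul, div_mul_cancel₀ _ hF1.ne'] at this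
    linarith
  -- The functional, normalized to map `1` to `1`.
  let Λ : CompactlySupportedContinuousMap X ℝ →ₚ[ℝ] ℝ := PositiveLinearMap.mk₀
    { toFun := fun g => (F 1)⁻¹ * F g.toContinuousMap
      map_add' := fun g g' => by
        rw [← mul_add, ← map_add]; rfl
      map_smul' := fun r g => by
        rw [RingHom.id_apply, smul_eq_mul, mul_left_comm, ← smul_eq_mul r, ← map_smul]; rfl }
    fun g hg => mul_nonneg (inv_nonneg.2 hF1.le) (hF0 _ hg)
  have hΛ : ∀ g : C(X, ℝ), Λ (CompactlySupportedContinuousMap.continuousMapEquiv g) =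
      (F 1)⁻¹ * F g := fun g => rfl
  have hΛ1 : Λ (CompactlySupportedContinuousMap.continuousMapEquiv 1) = 1 := by
    rw [hΛ, inv_mul_cancel₀ hF1.ne']
  refine ⟨RealRMK.rieszMeasure Λ, ⟨le_antisymm ?_ ?_⟩, fun i => ?_⟩
  · have := RealRMK.rieszMeasure_le_of_eq_one Λ
      (f := CompactlySupportedContinuousMap.continuousMapEquiv 1) (fun x => by simp)
      isCompact_univ (fun x _ => by simp)
    rwa [hΛ1, ENNReal.ofReal_one] at this
  · have := RealRMK.le_rieszMeasure_tsupport_subset Λ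
      (f := CompactlySupportedContinuousMap.continuousMapEquiv 1) (fun x => by simp)
      (Set.subset_univ _)
    rwa [hΛ1, ENNReal.ofReal_one] at this
  · have := RealRMK.rieszMeasure_le_of_eq_one Λ
      (f := CompactlySupportedContinuousMap.continuousMapEquiv (χ i))
      (fun x => by
        rw [CompactlySupportedContinuousMap.continuousMapEquiv_apply_toFun, hχ]
        exact NNReal.coe_nonneg _)
      (hA i).isClosed.isCompact
      (fun x hx => by
        rw [CompactlySupportedContinuousMap.continuousMapEquiv_apply_toFun, hχ]; simp [hx])
    refine this.trans ?_
    rw [← ENNReal.ofReal_coe_nnreal]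
    refine ENNReal.ofReal_le_ofReal ?_
    have h1 := hFv i
    have h2 : v i = (b i : ℝ) • 1 - χ i := by
      ext x; simp [v]
    rw [h2, map_sub, map_smul, smul_eq_mul, sub_nonneg] at h1
    rw [hΛ, inv_mul_le_iff₀ hF1, mul_comm]
    exact h1

/-- The minimax theorem for a σ-algebra that may be coarser than the Borel σ-algebra, such as the
product σ-algebra on an uncountable product. -/
theorem exists_probabilityMeasure_le [m : MeasurableSpace X] (hm : m ≤ borel X)
    {A : ι → Set X} (hA : ∀ i, IsClopen (A i)) (hAm : ∀ i, MeasurableSet (A i)) (b : ι → ℝ≥0)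
    (h : ∀ c : ι →₀ ℝ≥0, ∃ x, ∑ i ∈ c.support, c i * (A i).indicator 1 x ≤
      ∑ i ∈ c.support, c i * b i) :
    ∃ μ : ProbabilityMeasure X, ∀ i, (μ : Measure X) (A i) ≤ b i := by
  obtain ⟨μ, hμ, hle⟩ :=
    @exists_probabilityMeasure_le_of_borelSpace X ι _ _ _ (borel X)
      (@BorelSpace.mk _ _ (borel X) rfl) A hA b h
  refine ⟨⟨μ.trim hm, ⟨?_⟩⟩, fun i => ?_⟩
  · rw [trim_measurableSet_eq hm MeasurableSet.univ]
    exact hμ.measure_univ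
  · exact (trim_measurableSet_eq hm (hAm i)).trans_le (hle i)

end Minimax

/-! ### The space of partitions of the simplex -/

variable {k : ℕ}

theorem vertex_injective : Function.Injective (vertex : Fin k → Simplex k) := by
  intro i j hij
  by_contra hne
  have := congrFun (congrArg Subtype.val hij) i
  simp [vertex, hne] at this

theorem edgeLength_ne_top (e : Sym2 (Simplex k)) : edgeLength e ≠ ∞ := by
  induction e with
  | _ p q => exact ENNReal.ofReal_ne_top

/-- Any assignment of label sets to the points that is correct at the vertices can be refined to a
partition whose blocks depend only on the label sets. -/
theorem exists_partition_of_labels (L : Simplex k → Set (Fin k))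
    (hL : ∀ i, L (vertex i) = {i}) :
    ∃ f : SimplexPartition k, ∀ p q, L p = L q → f.1 p = f.1 q := by
  classical
  rcases isEmpty_or_nonempty (Fin k) with hk | ⟨⟨i₀⟩⟩
  · have hp : ∀ p : Simplex k, False := fun p => by
      have := p.2.2
      simp at this
    exact ⟨⟨fun p => (hp p).elim, fun i => isEmptyElim i⟩, fun p => (hp p).elim⟩
  · let pick : Set (Fin k) → Fin k := fun s => if h : s.Nonempty then h.some else i₀
    refine ⟨⟨fun p => pick (L p), fun i => ?_⟩, fun p q h => congrArg pick h⟩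
    have h : (L (vertex i)).Nonempty := by simp [hL]
    have h2 : h.some ∈ ({i} : Set (Fin k)) := hL i ▸ h.some_mem
    simpa [pick, h] using h2

instance : Nonempty (SimplexPartition k) := by
  obtain ⟨f, -⟩ := exists_partition_of_labels (fun p : Simplex k => {i | vertex i = p})
    (fun i => by ext j; simp [vertex_injective.eq_iff])
  exact ⟨f⟩

instance : CompactSpace (SimplexPartition k) := by
  refine isCompact_iff_compactSpace (s := {f : Simplex k → Fin k | ∀ i, f (vertex i) = i}).1
    (IsClosed.isCompact ?_)
  rw [Set.ofPred_forall]
  exact isClosed_iInter fun i => isClosed_eq (continuous_apply _) continuous_const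

theorem measurableSpace_le_borel :
    (inferInstance : MeasurableSpace (SimplexPartition k)) ≤ borel (SimplexPartition k) := by
  let _ : MeasurableSpace (SimplexPartition k) := borel _
  have : BorelSpace (SimplexPartition k) := ⟨rfl⟩
  have h : Measurable (Subtype.val : SimplexPartition k → Simplex k → Fin k) :=
    measurable_pi_iff.2 fun p =>
      ((continuous_apply p).comp continuous_subtype_val).measurable
  exact h.comap_le

/-- The set of partitions that cut a given pair of points. -/
def separating (e : Sym2 (Simplex k)) : Set (SimplexPartition k) :=
  {f | ¬ (Sym2.map f.1 e).IsDiag}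

theorem mem_separating_mk {f : SimplexPartition k} {p q : Simplex k} :
    f ∈ separating s(p, q) ↔ f.1 p ≠ f.1 q := by
  simp [separating]

theorem isClopen_separating (e : Sym2 (Simplex k)) : IsClopen (separating e) := by
  induction e with
  | _ p q =>
    have h : Continuous fun f : SimplexPartition k => (f.1 p, f.1 q) :=
      ((continuous_apply p).comp continuous_subtype_val).prodMk
        ((continuous_apply q).comp continuous_subtype_val)
    convert (isClopen_discrete {x : Fin k × Fin k | x.1 ≠ x.2}).preimage h using 1
    ext f
    exact mem_separating_mk

theorem measurableSet_separating (e : Sym2 (Simplex k)) : MeasurableSet (separating e) := by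
  induction e with
  | _ p q =>
    have h : Measurable fun f : SimplexPartition k => (f.1 p, f.1 q) :=
      ((measurable_pi_apply p).comp measurable_subtype_coe).prodMk
        ((measurable_pi_apply q).comp measurable_subtype_coe)
    convert h (MeasurableSet.of_discrete (s := {x : Fin k × Fin k | x.1 ≠ x.2})) using 1
    ext f
    exact mem_separating_mk

theorem measurable_toCut : Measurable (SimplexPartition.toCut (k := k)) :=
  Measurable.subtype_mk <| measurable_set_iff.2 fun e =>
    measurableSet_setOfPred.1 (measurableSet_separating e)

theorem measurableSet_mem_cut (e : Sym2 (Simplex k)) :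
    MeasurableSet {C : SimplexCut k | e ∈ C.1} :=
  measurableSet_setOfPred.2 ((measurable_set_mem e).comp measurable_subtype_coe)

/-! ### Partitions of small total cost -/

/-- Finiteness of the gap settles the case of minimum volume zero: there the quotient would be `∞`
unless the minimum cut is zero. -/
theorem WeightedGraph.minCut_le_integralityGap_mul_vol (G : WeightedGraph k) (φ : G.Embedding)
    (hgap : integralityGap k ≠ ∞) (hvol : G.vol φ ≠ ∞) :
    G.minCut ≤ integralityGap k * G.vol φ := by
  have h1 : G.minCut / G.minVol ≤ integralityGap k :=
    le_iSup (fun G : WeightedGraph k => G.minCut / G.minVol) G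
  have h2 : G.minVol ≤ G.vol φ := iInf_le _ φ
  have h3 : G.minCut ≤ integralityGap k * G.minVol :=
    (ENNReal.div_le_iff_le_mul (.inr hgap) (.inl (ne_top_of_le_ne_top hvol h2))).1 h1
  exact h3.trans (by gcongr)

theorem WeightedGraph.exists_cutCost_eq_minCut (G : WeightedGraph k) :
    ∃ C, IsKWayCut G.graph G.terminal C ∧ G.cutCost C = G.minCut := by
  have : Nonempty {C : Set (Sym2 (Fin G.n)) // IsKWayCut G.graph G.terminal C} := by
    refine ⟨G.graph.edgeSet, subset_rfl, fun i j hij => ?_⟩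
    simpa using hij
  obtain ⟨C, hC⟩ := exists_eq_ciInf_of_finite
    (f := fun C : {C : Set (Sym2 (Fin G.n)) // IsKWayCut G.graph G.terminal C} => G.cutCost C)
  exact ⟨C, C.2, hC⟩

/-- For finitely many weighted pairs of points, some partition has cut weight at most the
integrality gap times the total weighted length. It comes from a minimum cut of the complete graph
on the points involved and the vertices of the simplex. -/
theorem exists_partition_sum_le (hgap : integralityGap k ≠ ∞) (c : Sym2 (Simplex k) →₀ ℝ≥0) :
    ∃ f : SimplexPartition k,
      ∑ e ∈ c.support, (c e : ℝ≥0∞) * (separating e).indicator 1 f ≤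
        integralityGap k * ∑ e ∈ c.support, (c e : ℝ≥0∞) * edgeLength e := by
  classical
  let S : Finset (Simplex k) := Finset.univ.image vertex ∪ c.support.biUnion Sym2.toFinset
  have hvS : ∀ i, vertex i ∈ S := fun i => by simp [S]
  let ψ : Fin S.card → Simplex k := fun u => (S.equivFin.symm u).1
  have hψ : Function.Injective ψ := Subtype.val_injective.comp S.equivFin.symm.injective
  have hψS : ∀ p ∈ S, ∃ u, ψ u = p := fun p hp => ⟨S.equivFin ⟨p, hp⟩, by simp [ψ]⟩
  let t : Fin k ↪ Fin S.card :=
    ⟨fun i => S.equivFin ⟨vertex i, hvS i⟩, fun i j hij => vertex_injective (by simpa using hij)⟩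
  have hψt : ∀ i, ψ (t i) = vertex i := fun i =>
    congrArg Subtype.val (S.equivFin.symm_apply_apply ⟨vertex i, hvS i⟩)
  let G : WeightedGraph k := ⟨S.card, ⊤, fun e => c (Sym2.map ψ e), t⟩
  let φ : G.Embedding := ⟨ψ, hψt⟩
  have hmap : Function.Injective (Sym2.map ψ) := Sym2.map.injective hψ
  have hvol : G.vol φ ≤ ∑ e ∈ c.support, (c e : ℝ≥0∞) * edgeLength e := by
    rw [← tsum_eq_sum (L := .unconditional _) (f := fun e => (c e : ℝ≥0∞) * edgeLength e)
      (fun e he => by simp [Finsupp.notMem_support_iff.1 he])]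
    exact ENNReal.tsum_comp_le_tsum_of_injective
      (f := fun e : G.graph.edgeSet => Sym2.map ψ e.1) (hmap.comp Subtype.val_injective)
      (fun e => (c e : ℝ≥0∞) * edgeLength e)
  have hfin : ∑ e ∈ c.support, (c e : ℝ≥0∞) * edgeLength e ≠ ∞ :=
    ENNReal.sum_ne_top.2 fun e _ => ENNReal.mul_ne_top ENNReal.coe_ne_top (edgeLength_ne_top e)
  obtain ⟨C, hC, hCmin⟩ := G.exists_cutCost_eq_minCut
  -- A node is labelled by the terminals from which it is reachable after the cut. Points that are
  -- not nodes get the empty label set.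
  let H := G.graph.deleteEdges C
  let L : Simplex k → Set (Fin k) := fun p => {i | ∃ u, ψ u = p ∧ H.Reachable (t i) u}
  obtain ⟨f, hf⟩ := exists_partition_of_labels L fun i => by
    ext j
    constructor
    · rintro ⟨u, hu, hr⟩
      obtain rfl : u = t i := hψ (hu.trans (hψt i).symm)
      by_contra hne
      exact hC.2 j i hne hr
    · rintro rfl
      exact ⟨t j, hψt j, SimpleGraph.Reachable.refl _⟩
  have hLψ : ∀ u, L (ψ u) = {i | H.Reachable (t i) u} := fun u => by
    ext i
    exact ⟨fun ⟨w, hw, hr⟩ => hψ hw ▸ hr, fun hr => ⟨u, rfl, hr⟩⟩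
  have hcut : ∀ e ∈ c.support, f ∈ separating e → e ∈ Sym2.map ψ '' C := by
    intro e he hfe
    induction e with
    | _ p q =>
      have hpS : ∀ x ∈ s(p, q), x ∈ S := fun x hx =>
        Finset.mem_union_right _ (Finset.mem_biUnion.2 ⟨_, he, Sym2.mem_toFinset.2 hx⟩)
      obtain ⟨u, rfl⟩ := hψS p (hpS p (Sym2.mem_mk_left _ _))
      obtain ⟨w, rfl⟩ := hψS q (hpS q (Sym2.mem_mk_right _ _))
      rw [mem_separating_mk] at hfe
      refine ⟨s(u, w), ?_, rfl⟩
      by_contra hnot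
      have hadj : H.Adj u w := by
        rw [SimpleGraph.deleteEdges_adj]
        exact ⟨(SimpleGraph.top_adj u w).2 fun h => hfe (by rw [h]), hnot⟩
      refine hfe (hf _ _ ?_)
      rw [hLψ, hLψ]
      ext i
      exact ⟨fun h => h.trans hadj.reachable, fun h => h.trans hadj.reachable.symm⟩
  refine ⟨f, ?_⟩
  calc ∑ e ∈ c.support, (c e : ℝ≥0∞) * (separating e).indicator 1 f
      ≤ ∑ e ∈ c.support, (Sym2.map ψ '' C).indicator (fun e => (c e : ℝ≥0∞)) e := by
        refine Finset.sum_le_sum fun e he => ?_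
        by_cases hfe : f ∈ separating e
        · simp only [Set.indicator_of_mem hfe, Set.indicator_of_mem (hcut e he hfe),
            Pi.one_apply, mul_one, le_refl]
        · simp [hfe]
    _ ≤ ∑' e, (Sym2.map ψ '' C).indicator (fun e => (c e : ℝ≥0∞)) e := ENNReal.sum_le_tsum _
    _ = G.cutCost C := by
        rw [← tsum_subtype, tsum_image (fun e => (c e : ℝ≥0∞)) hmap.injOn]
        rfl
    _ = G.minCut := hCmin
    _ ≤ integralityGap k * G.vol φ :=
        G.minCut_le_integralityGap_mul_vol φ hgap (ne_top_of_le_ne_top hfin hvol)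
    _ ≤ _ := by gcongr

theorem exists_measure_separating_le (hgap : integralityGap k ≠ ∞) :
    ∃ Q : ProbabilityMeasure (SimplexPartition k), ∀ e,
      (Q : Measure (SimplexPartition k)) (separating e) ≤ integralityGap k * edgeLength e := by
  have hb : ∀ e : Sym2 (Simplex k), ((integralityGap k * edgeLength e).toNNReal : ℝ≥0∞) =
      integralityGap k * edgeLength e := fun e =>
    ENNReal.coe_toNNReal (ENNReal.mul_ne_top hgap (edgeLength_ne_top e))
  obtain ⟨Q, hQ⟩ := exists_probabilityMeasure_le measurableSpace_le_borel
    isClopen_separating measurableSet_separating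
    (fun e : Sym2 (Simplex k) => (integralityGap k * edgeLength e).toNNReal) fun c => by
      obtain ⟨f, hf⟩ := exists_partition_sum_le hgap c
      refine ⟨f, ENNReal.coe_le_coe.1 ?_⟩
      rw [Finset.mul_sum] at hf
      push_cast
      simp only [hb]
      convert hf using 2 with e _ e _
      · by_cases hfe : f ∈ separating e <;> simp [hfe]
      · ring
  exact ⟨Q, fun e => (hQ e).trans_eq (hb e)⟩

/-! ### The gap is a lower bound for the maximum density -/

/-- A cut of the complete graph pulls back along any map of the vertices that preserves terminals.
The map may identify vertices, since a collapsed edge cannot disconnect anything. -/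
theorem IsKWayCut.preimage {V W : Type*} {G : SimpleGraph V} {t : Fin k → V} {s : Fin k → W}
    {C : Set (Sym2 W)} (hC : IsKWayCut ⊤ s C) (φ : V → W) (hφ : ∀ i, φ (t i) = s i) :
    IsKWayCut G t {e ∈ G.edgeSet | Sym2.map φ e ∈ C} := by
  refine ⟨Set.sep_subset _ _, fun i j hij hr => hC.2 i j hij ?_⟩
  rw [← hφ, ← hφ]
  generalize t i = u, t j = w at hr
  obtain ⟨p⟩ := hr
  induction p with
  | nil => exact SimpleGraph.Reachable.refl _
  | @cons u v w h _ ih =>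
    refine SimpleGraph.Reachable.trans ?_ ih
    rw [SimpleGraph.deleteEdges_adj] at h
    by_cases huv : φ u = φ v
    · rw [huv]
    · refine SimpleGraph.Adj.reachable ?_
      rw [SimpleGraph.deleteEdges_adj]
      exact ⟨huv, fun hmem => h.2 ⟨h.1, hmem⟩⟩

/-- This includes the degenerate pairs, which have length zero and lie in no cut. -/
theorem measure_mem_cut_le (P : CuttingScheme k) (e : Sym2 (Simplex k)) :
    (P : Measure (SimplexCut k)) {C | e ∈ C.1} ≤ maxDensity P * edgeLength e := by
  by_cases he : e ∈ (⊤ : SimpleGraph (Simplex k)).edgeSet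
  · have h0 : edgeLength e ≠ 0 := by
      induction e with
      | _ p q =>
        intro h
        have h1 : (∑ l : Fin k, |p.1 l - q.1 l|) / 2 ≤ 0 := ENNReal.ofReal_eq_zero.1 h
        have h2 : ∑ l : Fin k, |p.1 l - q.1 l| = 0 :=
          le_antisymm (by linarith) (Finset.sum_nonneg fun l _ => abs_nonneg _)
        rw [Finset.sum_eq_zero_iff_of_nonneg fun l _ => abs_nonneg _] at h2
        refine (SimpleGraph.top_adj p q).1 he (Subtype.ext (funext fun l => ?_))
        exact sub_eq_zero.1 (abs_eq_zero.1 (h2 l (Finset.mem_univ l)))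
    rw [← ENNReal.div_le_iff_le_mul (.inl h0) (.inl (edgeLength_ne_top e))]
    exact le_iSup (fun e : (⊤ : SimpleGraph (Simplex k)).edgeSet => density P e) ⟨e, he⟩
  · have : {C : SimplexCut k | e ∈ C.1} = ∅ :=
      Set.eq_empty_of_forall_notMem fun C hC => he (C.2.1 hC)
    simp [this]

theorem WeightedGraph.minCut_le_maxDensity_mul_vol (G : WeightedGraph k) (φ : G.Embedding)
    (P : CuttingScheme k) : G.minCut ≤ maxDensity P * G.vol φ := by
  let A : Sym2 (Fin G.n) → Set (SimplexCut k) := fun e => {C | Sym2.map φ.1 e ∈ C.1}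
  have hA : ∀ e, MeasurableSet (A e) := fun e => measurableSet_mem_cut _
  have hcut : ∀ C : SimplexCut k, G.minCut ≤
      ∑' e : G.graph.edgeSet, (A e).indicator (fun _ => (G.cost e : ℝ≥0∞)) C := by
    intro C
    refine (iInf_le _ ⟨_, C.2.preimage φ.1 φ.2⟩).trans ?_
    rw [WeightedGraph.cutCost, tsum_subtype _ fun e => (G.cost e : ℝ≥0∞),
      tsum_subtype G.graph.edgeSet fun e => (A e).indicator (fun _ => (G.cost e : ℝ≥0∞)) C]
    refine ENNReal.tsum_le_tsum fun e => ?_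
    by_cases h1 : e ∈ G.graph.edgeSet <;> by_cases h2 : Sym2.map φ.1 e ∈ C.1 <;>
      simp [A, h1, h2, Set.indicator]
  calc G.minCut = ∫⁻ _, G.minCut ∂(P : Measure (SimplexCut k)) := by simp
    _ ≤ ∫⁻ C, ∑' e : G.graph.edgeSet, (A e).indicator (fun _ => (G.cost e : ℝ≥0∞)) C
          ∂(P : Measure (SimplexCut k)) := lintegral_mono hcut
    _ = ∑' e : G.graph.edgeSet, (G.cost e : ℝ≥0∞) * (P : Measure (SimplexCut k)) (A e) := by
        rw [lintegral_tsum fun e : G.graph.edgeSet =>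
          (measurable_const.indicator (hA e)).aemeasurable]
        simp_rw [lintegral_indicator_const (hA _)]
    _ ≤ ∑' e : G.graph.edgeSet,
          maxDensity P * ((G.cost e : ℝ≥0∞) * edgeLength (Sym2.map φ.1 e)) := by
        refine ENNReal.tsum_le_tsum fun e => ?_
        rw [mul_left_comm]
        gcongr
        exact measure_mem_cut_le P _
    _ = maxDensity P * G.vol φ := ENNReal.tsum_mul_left

theorem integralityGap_le_maxDensity (P : CuttingScheme k) :
    integralityGap k ≤ maxDensity P := by
  refine iSup_le fun G => ?_
  rcases eq_or_ne (maxDensity P) ∞ with htop | htop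
  · rw [htop]; exact le_top
  refine ENNReal.div_le_of_le_mul ?_
  rcases isEmpty_or_nonempty G.Embedding with hE | hE
  · -- There is no embedding only if `k = 0`, and then the empty set is a cut.
    have hk : k = 0 := by
      by_contra hk
      have : NeZero k := ⟨hk⟩
      exact hE.elim ⟨Function.extend G.terminal vertex fun _ => vertex 0,
        fun i => G.terminal.injective.extend_apply _ _ i⟩
    subst hk
    have : G.minCut ≤ G.cutCost ∅ :=
      iInf_le _ (⟨∅, Set.empty_subset _, fun i => i.elim0⟩ :
        {C : Set (Sym2 (Fin G.n)) // IsKWayCut G.graph G.terminal C})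
    refine this.trans ?_
    simp [WeightedGraph.cutCost]
  · rw [WeightedGraph.minVol, ENNReal.mul_iInf fun h => (htop h).elim]
    exact le_iInf fun φ => G.minCut_le_maxDensity_mul_vol φ P

/-! ### Existence of an optimal scheme -/

theorem exists_partition_scheme_maxDensity_le (k : ℕ) :
    ∃ (P : CuttingScheme k) (Q : ProbabilityMeasure (SimplexPartition k)),
      (P : Measure (SimplexCut k)) =
        (Q : Measure (SimplexPartition k)).map SimplexPartition.toCut ∧
      maxDensity P ≤ integralityGap k := by
  obtain ⟨Q, hQ⟩ : ∃ Q : ProbabilityMeasure (SimplexPartition k), integralityGap k ≠ ∞ → ∀ e,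
      (Q : Measure (SimplexPartition k)) (separating e) ≤ integralityGap k * edgeLength e := by
    by_cases hgap : integralityGap k = ∞
    · exact ⟨⟨Measure.dirac (Classical.arbitrary _), inferInstance⟩, fun h => (h hgap).elim⟩
    · obtain ⟨Q, hQ⟩ := exists_measure_separating_le hgap
      exact ⟨Q, fun _ => hQ⟩
  refine ⟨Q.map measurable_toCut.aemeasurable, Q, rfl, ?_⟩
  by_cases hgap : integralityGap k = ∞
  · rw [hgap]; exact le_top
  refine iSup_le fun e => ENNReal.div_le_of_le_mul ?_
  rw [ProbabilityMeasure.toMeasure_map,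
    Measure.map_apply measurable_toCut (measurableSet_mem_cut _)]
  exact hQ hgap e

end MultiwayCut

theorem mainTheorem4 (k : ℕ) :
    (∃ P : MultiwayCut.CuttingScheme k,
      MultiwayCut.maxDensity P = MultiwayCut.integralityGap k ∧
      ∃ Q : MeasureTheory.ProbabilityMeasure (MultiwayCut.SimplexPartition k),
        (P : MeasureTheory.Measure (MultiwayCut.SimplexCut k)) =
          (Q : MeasureTheory.Measure (MultiwayCut.SimplexPartition k)).map
            MultiwayCut.SimplexPartition.toCut) ∧
    MultiwayCut.minMaxDensity k = MultiwayCut.integralityGap k := by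
  obtain ⟨P, Q, hPQ, hP⟩ := MultiwayCut.exists_partition_scheme_maxDensity_le k
  exact ⟨⟨P, hP.antisymm (MultiwayCut.integralityGap_le_maxDensity P), Q, hPQ⟩,
    le_antisymm ((iInf_le _ P).trans hP) (le_iInf MultiwayCut.integralityGap_le_maxDensity)⟩
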